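/- Let $J\in\frac12\mathbb{N}_0$, $d=2J+1$, and let $S_z$ be the spin-$J$ operator with eigenvalues $J,J-1,\dots,-J$ on the basis $|1\rangle,\dots,|d\rangle$ of $\mathbb{C}^d$; put $u_g=e^{igS_z}$. For matrices $A_1,\dots,A_d\in M_D(\mathbb{C})$ and $N\ge 1$ let $$|\psi_A^{(N)}\rangle=\sum_{i_1,\dots,i_N=1}^d \mathrm{tr}(A_{i_1}\cdots A_{i_N})\,|i_1\cdots i_N\rangle ,\qquad \mathbb{E}_A(X)=\sum_i A_iXA_i^\dagger .$$ A canonical form of this matrix product state (MPS) consists of finitely many blocks $A^k=(A^k_i)_{i}$ and weights $\lambda_k>0$ such that $\psi_A^{(N)}$ is generated by the block-diagonal matrices $\bigoplus_k\lambda_kA_i^k$ for every $N\ge1$, where for each $k$: $\sum_iA^k_iA_i^{k\dagger}=\mathbb{1}$; $\sum_iA_i^{k\dagger}\Lambda_kA^k_i=\Lambda_k$ for some diagonal positive full-rank $\Lambda_k$; and $1$ is a nondegenerate eigenvalue, of maximal modulus, of $\mathbb{E}_{A^k}$ (other eigenvalues of modulus one are allowed). The period $\beta_k$ of a block is the number of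 eigenvalues of $\mathbb{E}_{A^k}$ of modulus one, and a block is called $\beta$-periodic if $\beta_k=\beta$ and these eigenvalues are exactly the $\beta$-th roots of unity. Suppose that the MPS is $U(1)$-symmetric with magnetization per particle $m\in\mathbb{R}$, that is, $u_g^{\otimes N}|\psi_A^{(N)}\rangle=e^{igNm}|\psi_A^{(N)}\rangle$ for all $g\in\mathbb{R}$ and for all $N\geq 1$ (or only for all $N\ge1$ that are multiples of some fixed $n_0\ge1$), and that $J-m=\frac qp$ with $q\in\mathbb{Z}$, $p\geq 1$ and $\gcd(p,q)=1$. Then, for every canonical form of the MPS: 1. Only blocks whose period is a multiple of $p$ appear: there is an integer $\gamma\ge1$ such that each block $A^k$ is $\gamma_kp$-periodic for some integer $\gamma_k\geq 1$ dividing $\gamma$. In particular, all eigenvalues of modulus one of all the maps $\mathbb{E}_{A^k}$ are $\gamma p$-th roots of unity. 2. Blocks of different periods give different states: if $\beta_k\ne\beta_l$, then for every sufficiently large $N$ divisible by $\beta_k$ or by $\beta_l$ neither of the vectors $|\psi_{A^k}^{(N)}\rangle$ and $|\psi_{A^l}^{(N)}\rangle$ is a nonzero scalar multiple of the other (in particular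 they are different). -/

import Mathlib

namespace MPS

/-- The vector `∑ tr(A_{i₁} ⋯ A_{i_N}) |i₁ ⋯ i_N⟩` of `(ℂ^d)^{⊗N}`, given by its coefficients in the
product basis: the translationally invariant matrix product state with matrices `A i`. -/
noncomputable def state {d : ℕ} {n : Type*} [Fintype n] [DecidableEq n]
    (A : Fin d → Matrix n n ℂ) (N : ℕ) : (Fin N → Fin d) → ℂ :=
  fun i => ((List.ofFn fun k => A (i k)).prod).trace

/-- The `N`-fold tensor power `u ⊗ ⋯ ⊗ u` of a one-site operator, in the product basis. -/
def tensorPower {d : ℕ} (u : Matrix (Fin d) (Fin d) ℂ) (N : ℕ) :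
    Matrix (Fin N → Fin d) (Fin N → Fin d) ℂ :=
  Matrix.of fun i j => ∏ k, u (i k) (j k)

/-- The rotation `u_g = exp(i g S_z)` of a spin `J = s / 2`. The basis vector with index
`k = 0, …, s` has `S_z`-eigenvalue `J - k`. -/
noncomputable def spinRotation (s : ℕ) (g : ℝ) : Matrix (Fin (s + 1)) (Fin (s + 1)) ℂ :=
  Matrix.diagonal fun k => Complex.exp (Complex.I * (g : ℂ) * ((s : ℂ) / 2 - ((k : ℕ) : ℂ)))

/-- `U(1)` symmetry of a vector of `N` spins `J = s / 2`, with magnetization per particle `m`: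
`u_g^{⊗N} ψ = e^{i g N m} ψ` for all `g`. -/
def IsU1Symmetric (s : ℕ) (m : ℝ) (N : ℕ) (ψ : (Fin N → Fin (s + 1)) → ℂ) : Prop :=
  ∀ g : ℝ, (tensorPower (spinRotation s g) N).mulVec ψ =
    Complex.exp (Complex.I * (g : ℂ) * (N : ℂ) * (m : ℂ)) • ψ

/-- The completely positive map `𝔼_A(X) = ∑ᵢ Aᵢ X Aᵢ†`. -/
noncomputable def transferMap {d : ℕ} {n : Type*} [Fintype n] [DecidableEq n]
    (A : Fin d → Matrix n n ℂ) : Matrix n n ℂ →ₗ[ℂ] Matrix n n ℂ where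
  toFun X := ∑ i, A i * X * (A i).conjTranspose
  map_add' X Y := by
    simp only [Matrix.mul_add, Matrix.add_mul, Finset.sum_add_distrib]
  map_smul' c X := by
    simp only [Matrix.mul_smul, Matrix.smul_mul, Finset.smul_sum, RingHom.id_apply]

/-- The conditions on one block of the canonical form: `∑ᵢ Aᵢ Aᵢ† = 1`; `∑ᵢ Aᵢ† Λ Aᵢ = Λ` for a
diagonal positive full rank `Λ`; and `1` is a nondegenerate eigenvalue of `𝔼_A` of maximal modulus
(other eigenvalues of modulus one may exist). -/
structure IsCanonicalBlock {d : ℕ} {n : Type*} [Fintype n] [DecidableEq n]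
    (A : Fin d → Matrix n n ℂ) : Prop where
  unital : ∑ i, A i * (A i).conjTranspose = 1
  exists_invariant : ∃ Λ : n → ℝ, (∀ a, 0 < Λ a) ∧
    ∑ i, (A i).conjTranspose * Matrix.diagonal (fun a => (Λ a : ℂ)) * A i =
      Matrix.diagonal (fun a => (Λ a : ℂ))
  nondegenerate : Module.finrank ℂ (Module.End.eigenspace (transferMap A) 1) = 1
  maximal : ∀ μ : ℂ, Module.End.HasEigenvalue (transferMap A) μ → ‖μ‖ ≤ 1

/-- The eigenvalues of `𝔼_A` of modulus one. -/
def peripheralSpectrum {d : ℕ} {n : Type*} [Fintype n] [DecidableEq n]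
    (A : Fin d → Matrix n n ℂ) : Set ℂ :=
  {μ : ℂ | ‖μ‖ = 1 ∧ Module.End.HasEigenvalue (transferMap A) μ}

/-- The period of a block: the number of eigenvalues of `𝔼_A` of modulus one. -/
noncomputable def period {d : ℕ} {n : Type*} [Fintype n] [DecidableEq n]
    (A : Fin d → Matrix n n ℂ) : ℕ :=
  (peripheralSpectrum A).ncard

/-- A block is `β`-periodic: `𝔼_A` has exactly `β ≥ 1` eigenvalues of modulus one, and they are the
`β`-th roots of unity. -/
def IsPeriodic {d : ℕ} {n : Type*} [Fintype n] [DecidableEq n]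
    (A : Fin d → Matrix n n ℂ) (β : ℕ) : Prop :=
  0 < β ∧ period A = β ∧ peripheralSpectrum A = {μ : ℂ | μ ^ β = 1}

/-- The data of a canonical form: finitely many canonical blocks with positive weights. -/
structure CanonicalForm (d : ℕ) where
  numBlocks : ℕ
  dim : Fin numBlocks → ℕ
  weight : Fin numBlocks → ℝ
  weight_pos : ∀ k, 0 < weight k
  block : ∀ k, Fin d → Matrix (Fin (dim k)) (Fin (dim k)) ℂ
  canonical : ∀ k, IsCanonicalBlock (block k)

/-- The block-diagonal matrices `⨁ₖ λₖ Aᵢᵏ` of a canonical form. -/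
noncomputable def CanonicalForm.matrices {d : ℕ} (C : CanonicalForm d) :
    Fin d → Matrix ((k : Fin C.numBlocks) × Fin (C.dim k)) ((k : Fin C.numBlocks) × Fin (C.dim k)) ℂ :=
  fun i => Matrix.blockDiagonal' fun k => (C.weight k : ℂ) • C.block k i

/-- `C` is a canonical form of the matrix product state with matrices `A`: both sets of matrices
generate the same vector for every number of sites. -/
def CanonicalForm.IsFormOf {d : ℕ} (C : CanonicalForm d) {D : ℕ}
    (A : Fin d → Matrix (Fin D) (Fin D) ℂ) : Prop :=
  ∀ N : ℕ, 0 < N → state A N = state C.matrices N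

end MPS

/-! Write basis indices as `k = 0, …, s`, so that `S_z = J - k`. Symmetry kills the coefficient of
every word of length `N` (with `n₀ ∣ N`) whose index sum is not `N (J - m) = N q / p`. That
coefficient is a sum over blocks, so cancellation between blocks must be excluded. Repeating a wrong
word keeps it wrong, so a power of its matrix product has all positive powers traceless; the product
is therefore nilpotent, and so is each of its diagonal blocks (`isNilpotent_wordProd`,
`CanonicalForm.isNilpotent_wordProd_block`). Hence each block state vanishes unless `p ∣ N`. But its
squared norm is `tr 𝔼^N`, which is at least `1/2` at all large multiples of the period, so `p`
divides the period (`IsCanonicalBlock.dvd_period`).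

The other ingredient is rigidity: a modulus-one eigenvector of a mixed transfer map is an invertible
intertwiner (`IsCanonicalBlock.exists_intertwiner`). For one block this makes the peripheral
spectrum a finite group, hence all roots of unity of its order. For two blocks it forces equal
periods; with different periods the mixed map has spectral radius below one, so overlaps tend to
zero while norms do not. -/

set_option linter.unusedSectionVars false

/-! ### Traces of powers and eigenvalues -/

section Trace

open Module

variable {V : Type*} [AddCommGroup V] [Module ℂ V] [FiniteDimensional ℂ V]

theorem Module.End.finite_maxGenEigenspace_ne_bot (f : End ℂ V) :
    {μ | f.maxGenEigenspace μ ≠ ⊥}.Finite :=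
  WellFoundedGT.finite_ne_bot_of_iSupIndep f.independent_maxGenEigenspace

theorem Module.End.maxGenEigenspace_ne_bot_iff (f : End ℂ V) (μ : ℂ) :
    f.maxGenEigenspace μ ≠ ⊥ ↔ f.HasEigenvalue μ := by
  refine ⟨fun h => ?_, fun h hbot => ?_⟩
  · rw [End.maxGenEigenspace_eq_genEigenspace_finrank] at h
    exact End.hasEigenvalue_of_hasGenEigenvalue (k := finrank ℂ V) h
  · refine h (eq_bot_iff.mpr (le_trans ?_ hbot.le))
    exact (f.genEigenspace μ).monotone le_top

/-- On a generalized eigenspace `f - μ` is nilpotent and commutes with `f ^ j`, so under the trace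
each factor `f` acts as the scalar `μ`. -/
theorem Module.End.trace_pow_eq_sum (f : End ℂ V) (j : ℕ) :
    LinearMap.trace ℂ V (f ^ j) = ∑ μ ∈ f.finite_maxGenEigenspace_ne_bot.toFinset,
      (finrank ℂ (f.maxGenEigenspace μ) : ℂ) * μ ^ j := by
  have hds := DirectSum.isInternal_submodule_of_iSupIndep_of_iSup_eq_top
    f.independent_maxGenEigenspace f.iSup_maxGenEigenspace_eq_top
  have hmaps (j : ℕ) (μ : ℂ) :
      Set.MapsTo (f ^ j) (f.maxGenEigenspace μ) (f.maxGenEigenspace μ) :=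
    f.mapsTo_maxGenEigenspace_of_comm ((Commute.refl f).pow_right j) μ
  rw [LinearMap.trace_eq_sum_trace_restrict' hds f.finite_maxGenEigenspace_ne_bot (hmaps j)]
  refine Finset.sum_congr rfl fun μ _ => ?_
  induction j with
  | zero =>
    have : (f ^ 0).restrict (hmaps 0 μ) = 1 := by ext x; rfl
    rw [this, LinearMap.trace_one, pow_zero, mul_one]
  | succ j ih =>
    have hf := f.mapsTo_maxGenEigenspace_of_comm rfl μ
    have : (f ^ (j + 1)).restrict (hmaps (j + 1) μ) =
        (f ^ j).restrict (hmaps j μ) ∘ₗ f.restrict hf := by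
      ext x; rfl
    have hcomm : Commute ((f ^ j).restrict (hmaps j μ)) (f.restrict hf) :=
      LinearMap.restrict_commute ((Commute.refl f).pow_left j) _ _
    rw [this, LinearMap.trace_comp_eq_mul_of_commute_of_isNilpotent μ hcomm
      (f.isNilpotent_restrict_maxGenEigenspace_sub_algebraMap μ), ih, pow_succ]
    ring

theorem eq_zero_of_sum_mul_pow_eq_zero (S : Finset ℂ) (c : ℂ → ℂ)
    (h : ∀ j : ℕ, 0 < j → ∑ x ∈ S, c x * x ^ j = 0) {y : ℂ} (hy : y ∈ S) (hy0 : y ≠ 0) :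
    c y = 0 := by
  -- Only positive powers are available, hence the extra factor `x`; this is why `y ≠ 0` is needed.
  have key (P : Polynomial ℂ) : ∑ x ∈ S, c x * (x * P.eval x) = 0 := by
    induction P using Polynomial.induction_on' with
    | add P Q hP hQ => simp only [Polynomial.eval_add, mul_add, Finset.sum_add_distrib, hP, hQ,
        add_zero]
    | monomial n a =>
      have := congrArg (a * ·) (h (n + 1) n.succ_pos)
      simp only [mul_zero, Finset.mul_sum] at this
      rw [← this]
      refine Finset.sum_congr rfl fun x _ => ?_
      rw [Polynomial.eval_monomial]
      ring
  -- An unnormalized Lagrange polynomial isolates the term at `y`.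
  have := key (∏ x ∈ S.erase y, (Polynomial.X - Polynomial.C x))
  rw [Finset.sum_eq_single_of_mem y hy] at this
  · simp only [Polynomial.eval_prod, Polynomial.eval_sub, Polynomial.eval_X,
      Polynomial.eval_C, mul_eq_zero, hy0, false_or, Finset.prod_eq_zero_iff] at this
    rcases this with h0 | ⟨x, hx, hxy⟩
    · exact h0
    · exact absurd (sub_eq_zero.mp hxy).symm (Finset.ne_of_mem_erase hx)
  · intro x hx hxy
    rw [Polynomial.eval_prod, Finset.prod_eq_zero (Finset.mem_erase.mpr ⟨hxy, hx⟩) (by simp)]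
    simp

theorem Module.End.isNilpotent_of_trace_pow_eq_zero (f : End ℂ V)
    (h : ∀ j : ℕ, 0 < j → LinearMap.trace ℂ V (f ^ j) = 0) : IsNilpotent f := by
  have hev (μ : ℂ) (hμ : μ ≠ 0) : f.maxGenEigenspace μ = ⊥ := by
    by_contra hne
    have := eq_zero_of_sum_mul_pow_eq_zero f.finite_maxGenEigenspace_ne_bot.toFinset
      (fun μ => (finrank ℂ (f.maxGenEigenspace μ) : ℂ))
      (fun j hj => by rw [← End.trace_pow_eq_sum, h j hj])
      (f.finite_maxGenEigenspace_ne_bot.mem_toFinset.mpr hne) hμ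
    exact hne (Submodule.finrank_eq_zero.mp (by exact_mod_cast this))
  have htop : f.maxGenEigenspace 0 = ⊤ := by
    rw [eq_top_iff, ← f.iSup_maxGenEigenspace_eq_top]
    refine iSup_le fun μ => ?_
    by_cases hμ : μ = 0
    · rw [hμ]
    · rw [hev μ hμ]; exact bot_le
  rw [End.maxGenEigenspace_eq_genEigenspace_finrank] at htop
  refine ⟨finrank ℂ V, LinearMap.ext fun x => ?_⟩
  have hx : x ∈ f.genEigenspace 0 (finrank ℂ V) := htop ▸ Submodule.mem_top
  simpa [End.mem_genEigenspace_nat] using hx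

theorem Matrix.isNilpotent_of_trace_pow_eq_zero {n : Type*} [Fintype n] [DecidableEq n]
    (M : Matrix n n ℂ) (h : ∀ j : ℕ, 0 < j → (M ^ j).trace = 0) : IsNilpotent M := by
  have : IsNilpotent (Matrix.toLinAlgEquiv' M) := by
    refine End.isNilpotent_of_trace_pow_eq_zero _ fun j hj => ?_
    rw [← map_pow]
    exact (Matrix.trace_toLin'_eq _).trans (h j hj)
  exact (IsNilpotent.map_iff (Matrix.toLinAlgEquiv' (R := ℂ) (n := n)).injective).mp this

/-- If all eigenvalues have modulus less than one, then the traces of powers tend to zero. -/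
theorem Module.End.tendsto_trace_pow_zero (f : End ℂ V)
    (h : ∀ μ, f.HasEigenvalue μ → ‖μ‖ < 1) :
    Filter.Tendsto (fun N : ℕ => LinearMap.trace ℂ V (f ^ N)) Filter.atTop (nhds 0) := by
  simp only [End.trace_pow_eq_sum]
  rw [← Finset.sum_const_zero (s := f.finite_maxGenEigenspace_ne_bot.toFinset)]
  refine tendsto_finsetSum _ fun μ hμ => ?_
  rw [Set.Finite.mem_toFinset] at hμ
  have := tendsto_pow_atTop_nhds_zero_of_norm_lt_one
    (h μ ((f.maxGenEigenspace_ne_bot_iff μ).mp hμ))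
  simpa using this.const_mul (finrank ℂ (f.maxGenEigenspace μ) : ℂ)

/-- If all eigenvalues lie in the closed unit disc, those of modulus one are `β`-th roots of unity
and `1` is among them, then `tr f ^ N` is bounded away from zero for large multiples `N` of `β`. -/
theorem Module.End.eventually_half_le_norm_trace_pow (f : End ℂ V) (β : ℕ)
    (hle : ∀ μ, f.HasEigenvalue μ → ‖μ‖ ≤ 1)
    (hroot : ∀ μ, f.HasEigenvalue μ → ‖μ‖ = 1 → μ ^ β = 1) (hone : f.HasEigenvalue 1) :
    ∀ᶠ N in Filter.atTop, β ∣ N → 1 / 2 ≤ ‖LinearMap.trace ℂ V (f ^ N)‖ := by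
  classical
  set S := f.finite_maxGenEigenspace_ne_bot.toFinset with hS
  have hmem (μ : ℂ) : μ ∈ S ↔ f.HasEigenvalue μ := by
    rw [hS, Set.Finite.mem_toFinset]; exact f.maxGenEigenspace_ne_bot_iff μ
  set r : ℂ → ℕ := fun μ => finrank ℂ (f.maxGenEigenspace μ) with hr
  have hinner : Filter.Tendsto
      (fun N : ℕ => ∑ μ ∈ S with ¬ ‖μ‖ = 1, (r μ : ℂ) * μ ^ N) Filter.atTop (nhds 0) := by
    rw [← Finset.sum_const_zero (s := S.filter fun μ => ¬ ‖μ‖ = 1)]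
    refine tendsto_finsetSum _ fun μ hμ => ?_
    rw [Finset.mem_filter, hmem] at hμ
    have := tendsto_pow_atTop_nhds_zero_of_norm_lt_one (lt_of_le_of_ne (hle μ hμ.1) hμ.2)
    simpa using this.const_mul (r μ : ℂ)
  have hev := (Metric.tendsto_nhds.mp hinner) (1 / 2) (by norm_num)
  filter_upwards [hev] with N hN hβ
  rw [End.trace_pow_eq_sum, ← Finset.sum_filter_add_sum_filter_not S (fun μ => ‖μ‖ = 1)]
  have hper : ∑ μ ∈ S with ‖μ‖ = 1, (r μ : ℂ) * μ ^ N =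
      ((∑ μ ∈ S with ‖μ‖ = 1, r μ : ℕ) : ℂ) := by
    rw [Nat.cast_sum]
    refine Finset.sum_congr rfl fun μ hμ => ?_
    rw [Finset.mem_filter, hmem] at hμ
    obtain ⟨c, rfl⟩ := hβ
    rw [pow_mul, hroot μ hμ.1 hμ.2, one_pow, mul_one]
  have hge : 1 ≤ ∑ μ ∈ S with ‖μ‖ = 1, r μ := by
    have h1 : (1 : ℂ) ∈ S.filter fun μ => ‖μ‖ = 1 := by simp [hmem, hone]
    refine le_trans ?_ (Finset.single_le_sum (f := r) (fun _ _ => Nat.zero_le _) h1)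
    refine Nat.one_le_iff_ne_zero.mpr fun h0 => ?_
    exact (f.maxGenEigenspace_ne_bot_iff 1).mpr hone (Submodule.finrank_eq_zero.mp h0)
  rw [dist_zero_right] at hN
  change 1 / 2 ≤ ‖∑ μ ∈ S with ‖μ‖ = 1, (r μ : ℂ) * μ ^ N +
    ∑ μ ∈ S with ¬ ‖μ‖ = 1, (r μ : ℂ) * μ ^ N‖
  rw [hper]
  have h1 := norm_sub_le_norm_add ((∑ μ ∈ S with ‖μ‖ = 1, r μ : ℕ) : ℂ)
    (∑ μ ∈ S with ¬ ‖μ‖ = 1, (r μ : ℂ) * μ ^ N)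
  rw [Complex.norm_natCast] at h1
  have h2 : (1 : ℝ) ≤ ((∑ μ ∈ S with ‖μ‖ = 1, r μ : ℕ) : ℝ) := by exact_mod_cast hge
  linarith

end Trace

/-! ### Transfer maps, words and overlaps -/

namespace MPS

open Module Matrix

variable {d : ℕ} {n κ : Type*} [Fintype n] [DecidableEq n] [Fintype κ] [DecidableEq κ]

/-- The mixed transfer map `X ↦ ∑ᵢ Aᵢ X Bᵢ†`. -/
noncomputable def mixedTransfer (A : Fin d → Matrix n n ℂ) (B : Fin d → Matrix κ κ ℂ) :
    End ℂ (Matrix n κ ℂ) where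
  toFun X := ∑ i, A i * X * (B i)ᴴ
  map_add' X Y := by simp only [Matrix.mul_add, Matrix.add_mul, Finset.sum_add_distrib]
  map_smul' c X := by
    simp only [Matrix.mul_smul, Matrix.smul_mul, Finset.smul_sum, RingHom.id_apply]

theorem mixedTransfer_apply (A : Fin d → Matrix n n ℂ) (B : Fin d → Matrix κ κ ℂ)
    (X : Matrix n κ ℂ) : mixedTransfer A B X = ∑ i, A i * X * (B i)ᴴ := rfl

theorem mixedTransfer_self (A : Fin d → Matrix n n ℂ) : mixedTransfer A A = transferMap A := rfl

theorem mixedTransfer_conjTranspose (A : Fin d → Matrix n n ℂ) (B : Fin d → Matrix κ κ ℂ)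
    (X : Matrix n κ ℂ) : mixedTransfer B A Xᴴ = (mixedTransfer A B X)ᴴ := by
  simp only [mixedTransfer_apply, conjTranspose_sum, conjTranspose_mul, conjTranspose_conjTranspose,
    Matrix.mul_assoc]

/-- The product of the matrices along a word. -/
def wordProd (A : Fin d → Matrix n n ℂ) {N : ℕ} (w : Fin N → Fin d) : Matrix n n ℂ :=
  (List.ofFn fun k => A (w k)).prod

theorem wordProd_cons (A : Fin d → Matrix n n ℂ) {N : ℕ} (i : Fin d) (w : Fin N → Fin d) :
    wordProd A (Fin.cons i w : Fin (N + 1) → Fin d) = A i * wordProd A w := by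
  simp [wordProd, List.ofFn_succ]

theorem state_apply (A : Fin d → Matrix n n ℂ) {N : ℕ} (w : Fin N → Fin d) :
    state A N w = (wordProd A w).trace := rfl

theorem mixedTransfer_pow_apply (A : Fin d → Matrix n n ℂ) (B : Fin d → Matrix κ κ ℂ) (N : ℕ)
    (X : Matrix n κ ℂ) :
    (mixedTransfer A B ^ N) X = ∑ w : Fin N → Fin d, wordProd A w * X * (wordProd B w)ᴴ := by
  induction N with
  | zero => simp [wordProd]
  | succ N ih =>
    rw [pow_succ', End.mul_apply, ih, mixedTransfer_apply,
      ← (Fin.consEquiv fun _ : Fin (N + 1) => Fin d).sum_comp, Fintype.sum_prod_type]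
    refine Finset.sum_congr rfl fun i _ => ?_
    rw [Matrix.mul_sum, Matrix.sum_mul]
    refine Finset.sum_congr rfl fun w _ => ?_
    change _ = wordProd A (Fin.cons i w : Fin (N + 1) → Fin d) * X *
      (wordProd B (Fin.cons i w : Fin (N + 1) → Fin d))ᴴ
    simp only [wordProd_cons, conjTranspose_mul, Matrix.mul_assoc]

/-- Turns overlaps of states into spectral data: in the basis of matrix units, `X ↦ P X Qᴴ` has
trace `tr P` times the conjugate of `tr Q`. -/
theorem trace_mixedTransfer_pow (A : Fin d → Matrix n n ℂ) (B : Fin d → Matrix κ κ ℂ) (N : ℕ) :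
    LinearMap.trace ℂ (Matrix n κ ℂ) (mixedTransfer A B ^ N) =
      ∑ w : Fin N → Fin d, state A N w * star (state B N w) := by
  rw [LinearMap.trace_eq_matrix_trace ℂ (Matrix.stdBasis ℂ n κ)]
  simp only [Matrix.trace, Matrix.diag, LinearMap.toMatrix_apply, Fintype.sum_prod_type,
    Matrix.stdBasis_eq_single]
  have hrepr (Y : Matrix n κ ℂ) (a : n) (b : κ) :
      (Matrix.stdBasis ℂ n κ).repr Y (a, b) = Y a b := by
    simp [Matrix.stdBasis]
  have hentry (P : Matrix n n ℂ) (Q : Matrix κ κ ℂ) (a : n) (b : κ) :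
      (P * Matrix.single a b (1 : ℂ) * Qᴴ) a b = P a a * star (Q b b) := by
    rw [Matrix.mul_apply, Finset.sum_eq_single b]
    · simp
    · intro c _ hc
      simp [hc]
    · simp
  simp only [hrepr, mixedTransfer_pow_apply, Matrix.sum_apply, hentry, state_apply,
    Matrix.trace, Matrix.diag, star_sum, Finset.sum_mul_sum]
  rw [Finset.sum_comm' (t' := Finset.univ) (s' := fun _ => Finset.univ) (by simp)]
  rw [Finset.sum_congr rfl fun b _ => Finset.sum_comm, Finset.sum_comm]
  refine Finset.sum_congr rfl fun w _ => ?_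
  rw [Finset.sum_comm]

/-- The weighted Frobenius square norm `∑ Λₐ |Y_{ab}|²`. -/
noncomputable def weightedNormSq (L : n → ℝ) (Y : Matrix n κ ℂ) : ℝ :=
  ∑ a, ∑ b, L a * ‖Y a b‖ ^ 2

theorem trace_diagonal_mul_mul_conjTranspose (L : n → ℝ) (Y : Matrix n κ ℂ) :
    (diagonal (fun a => (L a : ℂ)) * (Y * Yᴴ)).trace = (weightedNormSq L Y : ℂ) := by
  simp only [Matrix.trace, Matrix.diag, diagonal_mul, weightedNormSq, Complex.ofReal_sum]
  simp only [Matrix.mul_apply, conjTranspose_apply, Finset.mul_sum]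
  refine Finset.sum_congr rfl fun a _ => Finset.sum_congr rfl fun b _ => ?_
  rw [Complex.star_def, Complex.mul_conj, Complex.normSq_eq_norm_sq, Complex.ofReal_mul]

theorem weightedNormSq_nonneg {L : n → ℝ} (hL : ∀ a, 0 < L a) (Y : Matrix n κ ℂ) :
    0 ≤ weightedNormSq L Y :=
  Finset.sum_nonneg fun a _ => Finset.sum_nonneg fun _ _ =>
    mul_nonneg (hL a).le (sq_nonneg _)

theorem weightedNormSq_eq_zero {L : n → ℝ} (hL : ∀ a, 0 < L a) {Y : Matrix n κ ℂ}
    (h : weightedNormSq L Y = 0) : Y = 0 := by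
  have hnn (a : n) (b : κ) : 0 ≤ L a * ‖Y a b‖ ^ 2 := mul_nonneg (hL a).le (sq_nonneg _)
  ext a b
  have h1 := (Finset.sum_eq_zero_iff_of_nonneg
    fun a _ => Finset.sum_nonneg fun b _ => hnn a b).mp h a (Finset.mem_univ a)
  have h2 := (Finset.sum_eq_zero_iff_of_nonneg fun b _ => hnn a b).mp h1 b (Finset.mem_univ b)
  simpa [(hL a).ne'] using h2

/-! ### Rigidity: peripheral eigenvectors are intertwiners -/

theorem sum_conjTranspose_mul_diagonal_trace {A : Fin d → Matrix n n ℂ} {L : Matrix n n ℂ}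
    (hL : ∑ i, (A i)ᴴ * L * A i = L) (Y : Matrix n n ℂ) :
    (L * ∑ i, A i * Y * (A i)ᴴ).trace = (L * Y).trace := by
  conv_rhs => rw [← hL]
  rw [Matrix.mul_sum, Matrix.sum_mul, trace_sum, trace_sum]
  refine Finset.sum_congr rfl fun i _ => ?_
  rw [← Matrix.mul_assoc, Matrix.trace_mul_comm]
  simp only [Matrix.mul_assoc]

theorem sum_mul_conjTranspose_defect (A : Fin d → Matrix n n ℂ) {B : Fin d → Matrix κ κ ℂ}
    (hB : ∑ i, B i * (B i)ᴴ = 1) {X : Matrix n κ ℂ} {μ : ℂ} (hX : mixedTransfer A B X = μ • X) :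
    ∑ i, (A i * X - μ • (X * B i)) * (A i * X - μ • (X * B i))ᴴ =
      ∑ i, A i * (X * Xᴴ) * (A i)ᴴ - (μ * star μ) • (X * Xᴴ) := by
  have h1 : ∑ i, A i * X * (B i)ᴴ * Xᴴ = μ • (X * Xᴴ) := by
    rw [← Matrix.sum_mul, ← mixedTransfer_apply, hX, Matrix.smul_mul]
  have h2 : ∑ i, X * B i * (Xᴴ * (A i)ᴴ) = star μ • (X * Xᴴ) := by
    have := congrArg conjTranspose h1
    simpa only [conjTranspose_sum, conjTranspose_mul, conjTranspose_conjTranspose,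
      conjTranspose_smul, Matrix.mul_assoc] using this
  have h3 : ∑ i, X * B i * ((B i)ᴴ * Xᴴ) = X * Xᴴ := by
    have : ∑ i, X * B i * ((B i)ᴴ * Xᴴ) = X * (∑ i, B i * (B i)ᴴ) * Xᴴ := by
      simp only [Matrix.mul_sum, Matrix.sum_mul, Matrix.mul_assoc]
    rw [this, hB, Matrix.mul_one]
  have expand (i : Fin d) : (A i * X - μ • (X * B i)) * (A i * X - μ • (X * B i))ᴴ =
      A i * (X * Xᴴ) * (A i)ᴴ - star μ • (A i * X * (B i)ᴴ * Xᴴ)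
        - μ • (X * B i * (Xᴴ * (A i)ᴴ)) + (μ * star μ) • (X * B i * ((B i)ᴴ * Xᴴ)) := by
    simp only [conjTranspose_sub, conjTranspose_smul, conjTranspose_mul, Matrix.sub_mul,
      Matrix.mul_sub, Matrix.smul_mul, Matrix.mul_smul, Matrix.mul_assoc, smul_sub, smul_smul]
    rw [mul_comm (star μ) μ]
    abel
  simp only [expand, Finset.sum_add_distrib, Finset.sum_sub_distrib, ← Finset.smul_sum, h1, h2, h3,
    smul_smul]
  rw [mul_comm (star μ) μ]
  abel

/-- Pairing the defect identity with the invariant `Λ` gives `∑ᵢ ‖Aᵢ X - μ X Bᵢ‖²_Λ = (1 - |μ|²)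
‖X‖²_Λ`. The left side is nonnegative, and at `|μ| = 1` every summand vanishes. -/
theorem mixedTransfer_eigenvector {A : Fin d → Matrix n n ℂ} (hA : IsCanonicalBlock A)
    {B : Fin d → Matrix κ κ ℂ} (hB : ∑ i, B i * (B i)ᴴ = 1)
    {X : Matrix n κ ℂ} {μ : ℂ} (hX0 : X ≠ 0) (hX : mixedTransfer A B X = μ • X) :
    ‖μ‖ ≤ 1 ∧ (‖μ‖ = 1 → ∀ i, A i * X = μ • (X * B i)) := by
  obtain ⟨L, hLpos, hL⟩ := hA.exists_invariant
  have key : ∑ i, weightedNormSq L (A i * X - μ • (X * B i)) =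
      (1 - ‖μ‖ ^ 2) * weightedNormSq L X := by
    have h := congrArg (fun Y => (diagonal (fun a => (L a : ℂ)) * Y).trace)
      (sum_mul_conjTranspose_defect A hB hX)
    simp only [Matrix.mul_sub, Matrix.mul_sum, Matrix.mul_smul, trace_sub, trace_sum,
      trace_smul, trace_diagonal_mul_mul_conjTranspose] at h
    rw [← trace_sum, ← Matrix.mul_sum, sum_conjTranspose_mul_diagonal_trace hL,
      trace_diagonal_mul_mul_conjTranspose, Complex.star_def, Complex.mul_conj,
      Complex.normSq_eq_norm_sq, smul_eq_mul] at h
    have h' : ((∑ i, weightedNormSq L (A i * X - μ • (X * B i)) : ℝ) : ℂ) =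
        ((1 - ‖μ‖ ^ 2) * weightedNormSq L X : ℝ) := by
      push_cast
      push_cast at h
      rw [h]
      ring
    exact_mod_cast h'
  have hpos : 0 < weightedNormSq L X :=
    lt_of_le_of_ne (weightedNormSq_nonneg hLpos X)
      fun h => hX0 (weightedNormSq_eq_zero hLpos h.symm)
  constructor
  · have h0 : 0 ≤ (1 - ‖μ‖ ^ 2) * weightedNormSq L X :=
      key ▸ Finset.sum_nonneg fun i _ => weightedNormSq_nonneg hLpos _
    have := nonneg_of_mul_nonneg_left h0 hpos
    exact (sq_le_one_iff₀ (norm_nonneg μ)).mp (by linarith)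
  · intro hμ i
    rw [hμ, one_pow, sub_self, zero_mul,
      Finset.sum_eq_zero_iff_of_nonneg fun i _ => weightedNormSq_nonneg hLpos _] at key
    exact sub_eq_zero.mp (weightedNormSq_eq_zero hLpos (key i (Finset.mem_univ i)))

theorem IsCanonicalBlock.one_ne_zero {A : Fin d → Matrix n n ℂ} (hA : IsCanonicalBlock A) :
    (1 : Matrix n n ℂ) ≠ 0 := by
  intro h
  have hall (X : Matrix n n ℂ) : X = 0 := by rw [← Matrix.one_mul X, h, Matrix.zero_mul]
  have : End.eigenspace (transferMap A) 1 = ⊥ := (Submodule.eq_bot_iff _).mpr fun X _ => hall X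
  have hd := hA.nondegenerate
  rw [this, finrank_bot] at hd
  exact zero_ne_one hd

theorem IsCanonicalBlock.transferMap_one {A : Fin d → Matrix n n ℂ} (hA : IsCanonicalBlock A) :
    transferMap A 1 = 1 := by
  change ∑ i, A i * 1 * (A i)ᴴ = 1
  simpa only [Matrix.mul_one] using hA.unital

theorem IsCanonicalBlock.hasEigenvalue_one {A : Fin d → Matrix n n ℂ} (hA : IsCanonicalBlock A) :
    End.HasEigenvalue (transferMap A) 1 :=
  End.hasEigenvalue_of_hasEigenvector (x := (1 : Matrix n n ℂ))
    ⟨End.mem_eigenspace_iff.mpr (by rw [hA.transferMap_one, one_smul]), hA.one_ne_zero⟩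

theorem IsCanonicalBlock.eq_smul_one {A : Fin d → Matrix n n ℂ} (hA : IsCanonicalBlock A)
    {Y : Matrix n n ℂ} (hY : transferMap A Y = Y) : ∃ c : ℂ, Y = c • (1 : Matrix n n ℂ) := by
  have h1 : (1 : Matrix n n ℂ) ∈ End.eigenspace (transferMap A) 1 :=
    End.mem_eigenspace_iff.mpr (by rw [hA.transferMap_one, one_smul])
  have hY1 : Y ∈ End.eigenspace (transferMap A) 1 :=
    End.mem_eigenspace_iff.mpr (by rw [hY, one_smul])
  obtain ⟨c, hc⟩ := exists_smul_eq_of_finrank_eq_one hA.nondegenerate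
    (x := (⟨1, h1⟩ : End.eigenspace (transferMap A) 1))
    (fun h => hA.one_ne_zero (congrArg Subtype.val h)) ⟨Y, hY1⟩
  exact ⟨c, (congrArg Subtype.val hc).symm⟩

/-- The intertwining relation makes `X Xᴴ` a fixed point of `𝔼_A`, and the fixed space is spanned by
`1`. -/
theorem IsCanonicalBlock.exists_mul_conjTranspose {A : Fin d → Matrix n n ℂ}
    (hA : IsCanonicalBlock A) {B : Fin d → Matrix κ κ ℂ} (hB : ∑ i, B i * (B i)ᴴ = 1)
    {X : Matrix n κ ℂ} (hX0 : X ≠ 0) {μ : ℂ} (hμ : ‖μ‖ = 1)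
    (hX : ∀ i, A i * X = μ • (X * B i)) :
    ∃ c : ℂ, c ≠ 0 ∧ X * Xᴴ = c • (1 : Matrix n n ℂ) := by
  have hfix : transferMap A (X * Xᴴ) = X * Xᴴ := by
    change ∑ i, A i * (X * Xᴴ) * (A i)ᴴ = _
    have hterm (i : Fin d) : A i * (X * Xᴴ) * (A i)ᴴ = X * (B i * (B i)ᴴ) * Xᴴ := by
      have : A i * (X * Xᴴ) * (A i)ᴴ = (A i * X) * (A i * X)ᴴ := by
        simp only [conjTranspose_mul, Matrix.mul_assoc]
      rw [this, hX i]
      simp only [conjTranspose_smul, conjTranspose_mul, Matrix.smul_mul, Matrix.mul_smul, smul_smul,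
        Matrix.mul_assoc]
      rw [Complex.star_def, mul_comm, Complex.mul_conj, Complex.normSq_eq_norm_sq, hμ]
      simp
    simp only [hterm]
    rw [← Matrix.sum_mul, ← Matrix.mul_sum, hB, Matrix.mul_one]
  obtain ⟨c, hc⟩ := hA.eq_smul_one hfix
  refine ⟨c, fun h0 => hX0 ?_, hc⟩
  rw [h0, zero_smul] at hc
  open scoped ComplexOrder in exact Matrix.self_mul_conjTranspose_eq_zero.mp hc

/-- A modulus-one eigenvalue of the mixed transfer map of two canonical blocks comes from an
invertible intertwiner. -/
theorem IsCanonicalBlock.exists_intertwiner {A : Fin d → Matrix n n ℂ} (hA : IsCanonicalBlock A)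
    {B : Fin d → Matrix κ κ ℂ} (hB : IsCanonicalBlock B) {μ : ℂ} (hμ : ‖μ‖ = 1)
    (h : End.HasEigenvalue (mixedTransfer A B) μ) :
    ∃ (X : Matrix n κ ℂ) (Y : Matrix κ n ℂ), X * Y = 1 ∧ Y * X = 1 ∧
      ∀ i, A i * X = μ • (X * B i) := by
  obtain ⟨X, hX⟩ := h.exists_hasEigenvector
  have hX0 : X ≠ 0 := hX.2
  have hXe : mixedTransfer A B X = μ • X := hX.apply_eq_smul
  have hXt : mixedTransfer B A Xᴴ = star μ • Xᴴ := by
    rw [mixedTransfer_conjTranspose, hXe, conjTranspose_smul]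
  have hXt0 : Xᴴ ≠ 0 := fun h0 => hX0 (conjTranspose_eq_zero.mp h0)
  have hμ' : ‖star μ‖ = 1 := by rw [norm_star, hμ]
  have hAX := (mixedTransfer_eigenvector hA hB.unital hX0 hXe).2 hμ
  have hBX := (mixedTransfer_eigenvector hB hA.unital hXt0 hXt).2 hμ'
  obtain ⟨c, hc0, hc⟩ := hA.exists_mul_conjTranspose hB.unital hX0 hμ hAX
  obtain ⟨c', hc'0, hc'⟩ := hB.exists_mul_conjTranspose hA.unital hXt0 hμ' hBX
  rw [conjTranspose_conjTranspose] at hc'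
  -- Both `X Xᴴ` and `Xᴴ X` are scalar; bracketing `X Xᴴ X` in two ways identifies the scalars, so
  -- `c⁻¹ Xᴴ` is a two-sided inverse.
  have hcc : c • X = c' • X := by
    calc c • X = (X * Xᴴ) * X := by rw [hc, Matrix.smul_mul, Matrix.one_mul]
      _ = X * (Xᴴ * X) := Matrix.mul_assoc _ _ _
      _ = c' • X := by rw [hc', Matrix.mul_smul, Matrix.mul_one]
  have hceq : c = c' := smul_left_injective ℂ hX0 hcc
  refine ⟨X, c⁻¹ • Xᴴ, ?_, ?_, hAX⟩
  · rw [Matrix.mul_smul, hc, smul_smul, inv_mul_cancel₀ hc0, one_smul]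
  · rw [Matrix.smul_mul, hc', ← hceq, smul_smul, inv_mul_cancel₀ hc0, one_smul]

theorem IsCanonicalBlock.hasEigenvalue_of_intertwiner {A : Fin d → Matrix n n ℂ}
    (hA : IsCanonicalBlock A) {W : Matrix n n ℂ} (hW : W ≠ 0) {ν : ℂ}
    (h : ∀ i, A i * W = ν • (W * A i)) : End.HasEigenvalue (transferMap A) ν := by
  refine End.hasEigenvalue_of_hasEigenvector (x := W) ⟨End.mem_eigenspace_iff.mpr ?_, hW⟩
  change ∑ i, A i * W * (A i)ᴴ = _
  simp only [h, Matrix.smul_mul, Matrix.mul_assoc]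
  rw [← Finset.smul_sum, ← Matrix.mul_sum, hA.unital, Matrix.mul_one]

theorem IsCanonicalBlock.ne_zero_of_mul_eq_one {A : Fin d → Matrix n n ℂ}
    (hA : IsCanonicalBlock A) {X : Matrix n κ ℂ} {Y : Matrix κ n ℂ} (h : X * Y = 1) : X ≠ 0 := by
  rintro rfl
  exact hA.one_ne_zero (by rw [← h, Matrix.zero_mul])

theorem inv_intertwiner {A : Fin d → Matrix n n ℂ} {B : Fin d → Matrix κ κ ℂ}
    {X : Matrix n κ ℂ} {Y : Matrix κ n ℂ} (hXY : X * Y = 1) (hYX : Y * X = 1) {μ : ℂ}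
    (h : ∀ i, A i * X = μ • (X * B i)) (i : Fin d) : Y * A i = μ • (B i * Y) := by
  calc Y * A i = Y * (A i * X) * Y := by
        rw [Matrix.mul_assoc, Matrix.mul_assoc, hXY, Matrix.mul_one]
    _ = μ • (Y * X * B i * Y) := by
        rw [h i, Matrix.mul_smul, Matrix.smul_mul]; simp only [Matrix.mul_assoc]
    _ = μ • (B i * Y) := by rw [hYX, Matrix.one_mul]

/-- Conjugation by `X` carries self-intertwiners of `B` to self-intertwiners of `A`; the phase `μ`
cancels. -/
theorem peripheralSpectrum_subset_of_intertwiner {A : Fin d → Matrix n n ℂ}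
    (hA : IsCanonicalBlock A) {B : Fin d → Matrix κ κ ℂ} (hB : IsCanonicalBlock B)
    {X : Matrix n κ ℂ} {Y : Matrix κ n ℂ} (hXY : X * Y = 1) (hYX : Y * X = 1) {μ : ℂ}
    (h : ∀ i, A i * X = μ • (X * B i)) : peripheralSpectrum B ⊆ peripheralSpectrum A := by
  rintro ν ⟨hν, hev⟩
  obtain ⟨Z, Z', hZ, hZ', hBZ⟩ := hB.exists_intertwiner hB hν (by rwa [mixedTransfer_self])
  have hYA := inv_intertwiner hXY hYX h
  refine ⟨hν, hA.hasEigenvalue_of_intertwiner (W := X * Z * Y) ?_ fun i => ?_⟩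
  · refine hA.ne_zero_of_mul_eq_one (Y := X * Z' * Y) ?_
    calc X * Z * Y * (X * Z' * Y) = X * (Z * ((Y * X) * Z')) * Y := by
          simp only [Matrix.mul_assoc]
      _ = 1 := by rw [hYX, Matrix.one_mul, hZ, Matrix.mul_one, hXY]
  · calc A i * (X * Z * Y) = (A i * X) * Z * Y := by simp only [Matrix.mul_assoc]
      _ = μ • (X * (B i * Z) * Y) := by
          rw [h i]; simp only [Matrix.smul_mul, Matrix.mul_assoc]
      _ = ν • (X * Z * (μ • (B i * Y))) := by
          rw [hBZ i]
          simp only [Matrix.smul_mul, Matrix.mul_smul, Matrix.mul_assoc, smul_smul, mul_comm]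
      _ = ν • (X * Z * Y * A i) := by rw [← hYA i]; simp only [Matrix.mul_assoc]

/-! ### The peripheral spectrum as a group of roots of unity -/

theorem finite_peripheralSpectrum (A : Fin d → Matrix n n ℂ) : (peripheralSpectrum A).Finite :=
  (End.finite_maxGenEigenspace_ne_bot (transferMap A)).subset fun μ hμ =>
    (End.maxGenEigenspace_ne_bot_iff _ μ).mpr hμ.2

theorem IsCanonicalBlock.one_mem_peripheralSpectrum {A : Fin d → Matrix n n ℂ}
    (hA : IsCanonicalBlock A) : (1 : ℂ) ∈ peripheralSpectrum A :=
  ⟨norm_one, hA.hasEigenvalue_one⟩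

theorem IsCanonicalBlock.mul_mem_peripheralSpectrum {A : Fin d → Matrix n n ℂ}
    (hA : IsCanonicalBlock A) {μ ν : ℂ} (hμ : μ ∈ peripheralSpectrum A)
    (hν : ν ∈ peripheralSpectrum A) : μ * ν ∈ peripheralSpectrum A := by
  obtain ⟨X, X', hX, -, hAX⟩ := hA.exists_intertwiner hA hμ.1 hμ.2
  obtain ⟨Z, Z', hZ, -, hAZ⟩ := hA.exists_intertwiner hA hν.1 hν.2
  refine ⟨by rw [norm_mul, hμ.1, hν.1, one_mul],
    hA.hasEigenvalue_of_intertwiner (W := X * Z) ?_ fun i => ?_⟩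
  · refine hA.ne_zero_of_mul_eq_one (Y := Z' * X') ?_
    calc X * Z * (Z' * X') = X * (Z * Z') * X' := by simp only [Matrix.mul_assoc]
      _ = 1 := by rw [hZ, Matrix.mul_one, hX]
  · rw [← Matrix.mul_assoc, hAX, Matrix.smul_mul, Matrix.mul_assoc, hAZ, Matrix.mul_smul, smul_smul,
      Matrix.mul_assoc]

theorem intertwiner_symm {A : Fin d → Matrix n n ℂ} {B : Fin d → Matrix κ κ ℂ}
    {X : Matrix n κ ℂ} {Y : Matrix κ n ℂ} (hXY : X * Y = 1) (hYX : Y * X = 1) {μ : ℂ}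
    (hμ : μ ≠ 0) (h : ∀ i, A i * X = μ • (X * B i)) (i : Fin d) :
    B i * Y = μ⁻¹ • (Y * A i) := by
  rw [inv_intertwiner hXY hYX h, smul_smul, inv_mul_cancel₀ hμ, one_smul]

theorem ne_zero_of_mem_peripheralSpectrum {A : Fin d → Matrix n n ℂ} {μ : ℂ}
    (hμ : μ ∈ peripheralSpectrum A) : μ ≠ 0 :=
  norm_ne_zero_iff.mp (by rw [hμ.1]; exact one_ne_zero)

theorem IsCanonicalBlock.inv_mem_peripheralSpectrum {A : Fin d → Matrix n n ℂ}
    (hA : IsCanonicalBlock A) {μ : ℂ} (hμ : μ ∈ peripheralSpectrum A) :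
    μ⁻¹ ∈ peripheralSpectrum A := by
  obtain ⟨X, Y, hXY, hYX, hAX⟩ := hA.exists_intertwiner hA hμ.1 hμ.2
  exact ⟨by rw [norm_inv, hμ.1, inv_one],
    hA.hasEigenvalue_of_intertwiner (hA.ne_zero_of_mul_eq_one hYX)
      (intertwiner_symm hXY hYX (ne_zero_of_mem_peripheralSpectrum hμ) hAX)⟩

/-- The peripheral spectrum of a canonical block, as a group. -/
def peripheralSubgroup {A : Fin d → Matrix n n ℂ} (hA : IsCanonicalBlock A) : Subgroup ℂˣ where
  carrier := {u | (u : ℂ) ∈ peripheralSpectrum A}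
  mul_mem' hu hv := by
    simpa only [Set.mem_ofPred_eq, Units.val_mul] using hA.mul_mem_peripheralSpectrum hu hv
  one_mem' := hA.one_mem_peripheralSpectrum
  inv_mem' hu := by
    simpa only [Set.mem_ofPred_eq, Units.val_inv_eq_inv_val] using hA.inv_mem_peripheralSpectrum hu

theorem image_peripheralSubgroup {A : Fin d → Matrix n n ℂ} (hA : IsCanonicalBlock A) :
    Units.val '' (peripheralSubgroup hA : Set ℂˣ) = peripheralSpectrum A := by
  ext μ
  constructor
  · rintro ⟨u, hu, rfl⟩
    exact hu
  · exact fun hμ => ⟨Units.mk0 μ (ne_zero_of_mem_peripheralSpectrum hμ), hμ, rfl⟩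

theorem card_peripheralSubgroup {A : Fin d → Matrix n n ℂ} (hA : IsCanonicalBlock A) :
    Nat.card (peripheralSubgroup hA) = period A := by
  rw [period, ← image_peripheralSubgroup hA, Set.ncard_image_of_injective _ Units.val_injective]
  rfl

theorem IsCanonicalBlock.period_pos {A : Fin d → Matrix n n ℂ} (hA : IsCanonicalBlock A) :
    0 < period A :=
  (Set.ncard_pos (finite_peripheralSpectrum A)).mpr ⟨1, hA.one_mem_peripheralSpectrum⟩

theorem IsCanonicalBlock.pow_period_eq_one {A : Fin d → Matrix n n ℂ} (hA : IsCanonicalBlock A)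
    {μ : ℂ} (hμ : μ ∈ peripheralSpectrum A) : μ ^ period A = 1 := by
  let u : peripheralSubgroup hA :=
    ⟨Units.mk0 μ (ne_zero_of_mem_peripheralSpectrum hμ), hμ⟩
  have h := pow_card_eq_one' (x := u)
  rw [card_peripheralSubgroup] at h
  simpa [u] using congrArg (fun v : peripheralSubgroup hA => ((v : ℂˣ) : ℂ)) h

/-- By Lagrange's theorem the group lies among the roots of unity of its own order, and there are
only that many. -/
theorem IsCanonicalBlock.isPeriodic {A : Fin d → Matrix n n ℂ} (hA : IsCanonicalBlock A) :
    IsPeriodic A (period A) := by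
  refine ⟨hA.period_pos, rfl, ?_⟩
  have hroots : {μ : ℂ | μ ^ period A = 1} =
      (Polynomial.nthRootsFinset (period A) (1 : ℂ) : Set ℂ) := by
    ext μ
    simp [Polynomial.mem_nthRootsFinset hA.period_pos]
  refine Set.eq_of_subset_of_ncard_le (fun μ hμ => hA.pow_period_eq_one hμ) ?_ ?_
  · rw [hroots, Set.ncard_coe_finset,
      (Complex.isPrimitiveRoot_exp _ hA.period_pos.ne').card_nthRootsFinset]
    rfl
  · rw [hroots]
    exact Finset.finite_toSet _

/-! ### Norms and overlaps of block states -/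

theorem wordProd_mul_intertwiner {A : Fin d → Matrix n n ℂ} {B : Fin d → Matrix κ κ ℂ}
    {X : Matrix n κ ℂ} {μ : ℂ} (h : ∀ i, A i * X = μ • (X * B i)) {N : ℕ} (w : Fin N → Fin d) :
    wordProd A w * X = μ ^ N • (X * wordProd B w) := by
  induction N with
  | zero => simp [wordProd]
  | succ N ih =>
    rw [← Fin.cons_self_tail w, wordProd_cons, wordProd_cons, Matrix.mul_assoc, ih,
      Matrix.mul_smul, ← Matrix.mul_assoc, h, Matrix.smul_mul, smul_smul, pow_succ,
      Matrix.mul_assoc]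

/-- The state of a canonical block vanishes unless its period divides the number of sites. -/
theorem IsCanonicalBlock.state_eq_zero {A : Fin d → Matrix n n ℂ} (hA : IsCanonicalBlock A)
    {N : ℕ} (hN : ¬ period A ∣ N) : state A N = 0 := by
  have hζ := Complex.isPrimitiveRoot_exp _ hA.period_pos.ne'
  set ζ := Complex.exp (2 * Real.pi * Complex.I / period A)
  have hmem : ζ ∈ peripheralSpectrum A := hA.isPeriodic.2.2 ▸ hζ.pow_eq_one
  obtain ⟨X, Y, hXY, hYX, hAX⟩ := hA.exists_intertwiner hA hmem.1 hmem.2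
  ext w
  -- Since `Y = X⁻¹`, taking traces leaves `tr = ζ ^ N tr`, with `ζ` primitive of order the period.
  have h1 : wordProd A w = ζ ^ N • (X * wordProd A w * Y) := by
    rw [← Matrix.smul_mul, ← wordProd_mul_intertwiner hAX, Matrix.mul_assoc, hXY, Matrix.mul_one]
  have h2 : (wordProd A w).trace = ζ ^ N * (wordProd A w).trace := by
    conv_lhs => rw [h1]
    rw [trace_smul, Matrix.mul_assoc, Matrix.trace_mul_comm, Matrix.mul_assoc, hYX, Matrix.mul_one,
      smul_eq_mul]
  rw [state_apply, Pi.zero_apply]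
  by_contra h0
  exact hN ((hζ.pow_eq_one_iff_dvd N).mp (mul_right_cancel₀ h0 (by rw [one_mul]; exact h2.symm)))

theorem IsCanonicalBlock.eventually_half_le_norm_trace {A : Fin d → Matrix n n ℂ}
    (hA : IsCanonicalBlock A) : ∀ᶠ N in Filter.atTop, period A ∣ N →
      1 / 2 ≤ ‖∑ w : Fin N → Fin d, state A N w * star (state A N w)‖ := by
  have := End.eventually_half_le_norm_trace_pow (transferMap A) (period A) hA.maximal
    (fun μ hμ hn => hA.pow_period_eq_one ⟨hn, hμ⟩) hA.hasEigenvalue_one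
  rw [← mixedTransfer_self A] at this
  simpa only [trace_mixedTransfer_pow] using this

theorem IsCanonicalBlock.norm_lt_one_of_period_ne {A : Fin d → Matrix n n ℂ}
    (hA : IsCanonicalBlock A) {B : Fin d → Matrix κ κ ℂ} (hB : IsCanonicalBlock B)
    (hne : period A ≠ period B) {μ : ℂ} (h : End.HasEigenvalue (mixedTransfer A B) μ) :
    ‖μ‖ < 1 := by
  obtain ⟨X, hX⟩ := h.exists_hasEigenvector
  refine lt_of_le_of_ne (mixedTransfer_eigenvector hA hB.unital hX.2 hX.apply_eq_smul).1
    fun hμ => hne ?_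
  obtain ⟨X, Y, hXY, hYX, hAX⟩ := hA.exists_intertwiner hB hμ h
  have hμ0 : μ ≠ 0 := norm_ne_zero_iff.mp (by rw [hμ]; exact _root_.one_ne_zero)
  have := (peripheralSpectrum_subset_of_intertwiner hB hA hYX hXY
    (intertwiner_symm hXY hYX hμ0 hAX)).antisymm
    (peripheralSpectrum_subset_of_intertwiner hA hB hXY hYX hAX)
  rw [period, period, this]

/-- If only one period divides `N`, exactly one state vanishes. If both do and `ψ_A = z ψ_B`, put `t
= ‖ψ_B‖² ≥ 1/2`: the overlap bound `|z| t < 1/2` gives `|z| < 1`, hence `‖ψ_A‖² = |z|² t < 1/2`, a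
contradiction. -/
theorem IsCanonicalBlock.eventually_state_ne_smul {A : Fin d → Matrix n n ℂ}
    (hA : IsCanonicalBlock A) {B : Fin d → Matrix κ κ ℂ} (hB : IsCanonicalBlock B)
    (hne : period A ≠ period B) : ∀ᶠ N in Filter.atTop, (period A ∣ N ∨ period B ∣ N) →
      ∀ z : ℂ, z ≠ 0 → state A N ≠ z • state B N := by
  have hoverlap := Metric.tendsto_nhds.mp (End.tendsto_trace_pow_zero (mixedTransfer A B)
    fun μ hμ => hA.norm_lt_one_of_period_ne hB hne hμ) (1 / 2) (by norm_num)
  filter_upwards [hA.eventually_half_le_norm_trace, hB.eventually_half_le_norm_trace,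
    hoverlap] with N hNA hNB hNo hdvd z hz hstate
  have hzero (hdA : ¬ period A ∣ N) (hdB : period B ∣ N) : False := by
    have h0 := hA.state_eq_zero hdA
    rw [hstate, smul_eq_zero, or_iff_right hz] at h0
    have := hNB hdB
    simp only [h0, Pi.zero_apply, zero_mul, Finset.sum_const_zero, norm_zero] at this
    norm_num at this
  by_cases hdB : period B ∣ N
  · by_cases hdA : period A ∣ N
    · rw [trace_mixedTransfer_pow, dist_zero_right] at hNo
      have hAN := hNA hdA
      have hBN := hNB hdB
      have hAA : ∑ w : Fin N → Fin d, state A N w * star (state A N w) =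
          z * star z * ∑ w : Fin N → Fin d, state B N w * star (state B N w) := by
        rw [hstate, Finset.mul_sum]
        refine Finset.sum_congr rfl fun w _ => ?_
        rw [Pi.smul_apply, smul_eq_mul, star_mul]
        ring
      have hAB : ∑ w : Fin N → Fin d, state A N w * star (state B N w) =
          z * ∑ w : Fin N → Fin d, state B N w * star (state B N w) := by
        rw [hstate, Finset.mul_sum]
        refine Finset.sum_congr rfl fun w _ => ?_
        rw [Pi.smul_apply, smul_eq_mul, mul_assoc]
      rw [hAA, norm_mul, norm_mul, norm_star] at hAN
      rw [hAB, norm_mul] at hNo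
      nlinarith [norm_nonneg z]
    · exact hzero hdA hdB
  · have hdA := hdvd.resolve_right hdB
    have h0 := hNA hdA
    rw [hstate, hB.state_eq_zero hdB] at h0
    simp only [smul_zero, Pi.zero_apply, zero_mul, Finset.sum_const_zero, norm_zero] at h0
    norm_num at h0

/-! ### Magnetization of words and nilpotency -/

theorem tensorPower_spinRotation (s : ℕ) (g : ℝ) (N : ℕ) :
    tensorPower (spinRotation s g) N = diagonal fun w : Fin N → Fin (s + 1) =>
      Complex.exp (∑ k, Complex.I * (g : ℂ) * ((s : ℂ) / 2 - ((w k : ℕ) : ℂ))) := by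
  ext v w
  rw [tensorPower, Matrix.of_apply]
  by_cases hvw : v = w
  · subst hvw
    rw [diagonal_apply_eq, Complex.exp_sum]
    exact Finset.prod_congr rfl fun k _ => diagonal_apply_eq _ _
  · obtain ⟨k, hk⟩ := Function.ne_iff.mp hvw
    rw [diagonal_apply_ne _ hvw]
    exact Finset.prod_eq_zero (Finset.mem_univ k) (diagonal_apply_ne _ hk)

theorem eq_zero_of_forall_exp_eq_one {x : ℝ}
    (h : ∀ g : ℝ, Complex.exp (Complex.I * (g : ℂ) * (x : ℂ)) = 1) : x = 0 := by
  by_contra hx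
  have hx' : (x : ℂ) ≠ 0 := Complex.ofReal_ne_zero.mpr hx
  have h1 := h (Real.pi / x)
  have : Complex.I * ((Real.pi / x : ℝ) : ℂ) * (x : ℂ) = Real.pi * Complex.I := by
    push_cast
    field_simp
  rw [this, Complex.exp_pi_mul_I] at h1
  norm_num at h1

theorem IsU1Symmetric.sum_eq {s : ℕ} {m : ℝ} {N : ℕ} {ψ : (Fin N → Fin (s + 1)) → ℂ}
    (h : IsU1Symmetric s m N ψ) {w : Fin N → Fin (s + 1)} (hw : ψ w ≠ 0) :
    ((∑ k, (w k : ℕ) : ℕ) : ℝ) = N * ((s : ℝ) / 2 - m) := by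
  have hx : (N : ℝ) * ((s : ℝ) / 2 - m) - ((∑ k, (w k : ℕ) : ℕ) : ℝ) = 0 := by
    refine eq_zero_of_forall_exp_eq_one fun g => ?_
    have hg := congrFun (h g) w
    rw [tensorPower_spinRotation, mulVec_diagonal, Pi.smul_apply, smul_eq_mul] at hg
    have hexp := mul_right_cancel₀ hw hg
    have hsum : Complex.I * (g : ℂ) *
        (((N : ℝ) * ((s : ℝ) / 2 - m) - ((∑ k, (w k : ℕ) : ℕ) : ℝ) : ℝ) : ℂ) =
        (∑ k, Complex.I * (g : ℂ) * ((s : ℂ) / 2 - ((w k : ℕ) : ℂ))) -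
          Complex.I * (g : ℂ) * (N : ℂ) * (m : ℂ) := by
      rw [← Finset.mul_sum, Finset.sum_sub_distrib, Finset.sum_const, Finset.card_univ,
        Fintype.card_fin, nsmul_eq_mul]
      push_cast
      ring
    rw [hsum, Complex.exp_sub, hexp, div_self (Complex.exp_ne_zero _)]
  linarith

theorem state_get (A : Fin d → Matrix n n ℂ) (l : List (Fin d)) :
    state A l.length l.get = (l.map A).prod.trace := by
  rw [state_apply, wordProd]
  congr 2
  conv_rhs => rw [← List.ofFn_get l, List.map_ofFn]
  rfl

theorem wordProd_eq_map (A : Fin d → Matrix n n ℂ) {N : ℕ} (w : Fin N → Fin d) :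
    wordProd A w = ((List.ofFn w).map A).prod := by
  rw [List.map_ofFn]
  rfl

theorem prod_map_flatten_replicate {M : Type*} [Monoid M] {α : Type*} (f : α → M) (l : List α)
    (j : ℕ) : (((List.replicate j l).flatten).map f).prod = (l.map f).prod ^ j := by
  induction j with
  | zero => simp
  | succ j ih =>
    rw [List.replicate_succ, List.flatten_cons, List.map_append, List.prod_append, ih, pow_succ']

theorem sum_map_flatten_replicate {α : Type*} (f : α → ℕ) (l : List α) (j : ℕ) :
    (((List.replicate j l).flatten).map f).sum = j * (l.map f).sum := by
  induction j with
  | zero => simp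
  | succ j ih =>
    rw [List.replicate_succ, List.flatten_cons, List.map_append, List.sum_append, ih]
    ring

/-- For a symmetric family, the matrix product along a word of the wrong magnetization is
nilpotent. -/
theorem isNilpotent_wordProd {s : ℕ} {m : ℝ} {n₀ : ℕ} (hn₀ : 0 < n₀)
    {M : Fin (s + 1) → Matrix n n ℂ}
    (hsym : ∀ N : ℕ, 0 < N → n₀ ∣ N → IsU1Symmetric s m N (state M N))
    {N : ℕ} (hN : 0 < N) {w : Fin N → Fin (s + 1)}
    (hw : ((∑ k, (w k : ℕ) : ℕ) : ℝ) ≠ N * ((s : ℝ) / 2 - m)) : IsNilpotent (wordProd M w) := by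
  -- Symmetry is known only at multiples of `n₀`, so the word is repeated `n₀ * j` times; both sides
  -- of `hw` scale by this factor.
  refine IsNilpotent.of_pow (m := n₀)
    (Matrix.isNilpotent_of_trace_pow_eq_zero (wordProd M w ^ n₀) fun j hj => ?_)
  set l := (List.replicate (n₀ * j) (List.ofFn w)).flatten with hl
  have hlen : l.length = n₀ * j * N := by simp [hl]
  have hlpos : 0 < l.length := hlen ▸ Nat.mul_pos (Nat.mul_pos hn₀ hj) hN
  have hsum : ∑ k, ((l.get k : Fin (s + 1)) : ℕ) = n₀ * j * ∑ k, (w k : ℕ) := by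
    rw [← List.sum_ofFn, ← List.sum_ofFn]
    have h1 : (List.ofFn fun k => ((l.get k : Fin (s + 1)) : ℕ)) = l.map Fin.val := by
      conv_rhs => rw [← List.ofFn_get l, List.map_ofFn]
      rfl
    have h2 : (List.ofFn fun k => (w k : ℕ)) = (List.ofFn w).map Fin.val := by
      rw [List.map_ofFn]
      rfl
    rw [h1, h2, hl, sum_map_flatten_replicate]
  rw [← pow_mul, wordProd_eq_map, ← prod_map_flatten_replicate, ← state_get]
  by_contra h0
  have := (hsym l.length hlpos (by rw [hlen, mul_assoc]; exact dvd_mul_right _ _)).sum_eq h0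
  rw [hsum, hlen] at this
  push_cast at this hw
  have hpos : (0 : ℝ) < n₀ * j := by exact_mod_cast Nat.mul_pos hn₀ hj
  exact hw (mul_left_cancel₀ hpos.ne' (by rw [this]; ring))

/-! ### From the full state to its blocks -/

theorem CanonicalForm.wordProd_matrices (C : CanonicalForm d) {N : ℕ} (w : Fin N → Fin d) :
    wordProd C.matrices w =
      blockDiagonal' fun k => (C.weight k : ℂ) ^ N • wordProd (C.block k) w := by
  induction N with
  | zero => simp [wordProd, ← Pi.one_def, blockDiagonal'_one]
  | succ N ih =>
    rw [← Fin.cons_self_tail w, wordProd_cons, ih, CanonicalForm.matrices, ← blockDiagonal'_mul]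
    congr 1
    ext1 k
    rw [wordProd_cons, Matrix.smul_mul, Matrix.mul_smul, smul_smul, pow_succ']

theorem CanonicalForm.isNilpotent_wordProd_block (C : CanonicalForm d) {N : ℕ} {w : Fin N → Fin d}
    (h : IsNilpotent (wordProd C.matrices w)) (k : Fin C.numBlocks) :
    IsNilpotent (wordProd (C.block k) w) := by
  obtain ⟨r, hr⟩ := h
  rw [C.wordProd_matrices, ← blockDiagonal'_pow, ← blockDiagonal'_zero, blockDiagonal'_inj] at hr
  refine ⟨r, ?_⟩
  have hk := congrFun hr k
  rw [Pi.pow_apply, smul_pow, Pi.zero_apply, smul_eq_zero] at hk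
  refine hk.resolve_left (pow_ne_zero _ (pow_ne_zero _ ?_))
  exact_mod_cast ne_of_gt (C.weight_pos k)

/-- Every block of a canonical form of a symmetric matrix product state is itself symmetric. -/
theorem CanonicalForm.sum_eq_of_state_block_ne_zero {s : ℕ} {m : ℝ} {n₀ : ℕ} (hn₀ : 0 < n₀)
    (C : CanonicalForm (s + 1))
    (hsym : ∀ N : ℕ, 0 < N → n₀ ∣ N → IsU1Symmetric s m N (state C.matrices N))
    (k : Fin C.numBlocks) {N : ℕ} (hN : 0 < N) {w : Fin N → Fin (s + 1)}
    (hw : state (C.block k) N w ≠ 0) :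
    ((∑ k, (w k : ℕ) : ℕ) : ℝ) = N * ((s : ℝ) / 2 - m) := by
  by_contra hne
  refine hw ?_
  rw [state_apply]
  exact (Matrix.isNilpotent_trace_of_isNilpotent
    (C.isNilpotent_wordProd_block (isNilpotent_wordProd hn₀ hsym hN hne) k)).eq_zero

theorem IsCanonicalBlock.dvd_period {A : Fin d → Matrix n n ℂ} (hA : IsCanonicalBlock A) {p : ℕ}
    (h : ∀ N : ℕ, 0 < N → state A N ≠ 0 → p ∣ N) : p ∣ period A := by
  obtain ⟨N₀, hN₀⟩ := Filter.eventually_atTop.mp hA.eventually_half_le_norm_trace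
  have hdvd (j : ℕ) (hj : N₀ < j) : p ∣ period A * j := by
    refine h _ (Nat.mul_pos hA.period_pos (by omega)) fun h0 => ?_
    have := hN₀ (period A * j) (hj.le.trans (Nat.le_mul_of_pos_left j hA.period_pos))
      (dvd_mul_right _ _)
    simp only [h0, Pi.zero_apply, zero_mul, Finset.sum_const_zero, norm_zero] at this
    norm_num at this
  -- Two consecutive large multiples of the period are divisible by `p`, hence so is their
  -- difference, the period.
  have h1 := hdvd (N₀ + 1) (by omega)
  have h2 := hdvd (N₀ + 1 + 1) (by omega)
  rw [mul_add _ (N₀ + 1), mul_one] at h2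
  exact (Nat.dvd_add_right h1).mp h2

end MPS

theorem lemma8 (s D : ℕ) (A : Fin (s + 1) → Matrix (Fin D) (Fin D) ℂ)
    (m : ℝ) (n₀ : ℕ) (hn₀ : 0 < n₀)
    (hsym : ∀ N : ℕ, 0 < N → n₀ ∣ N → MPS.IsU1Symmetric s m N (MPS.state A N))
    (q : ℤ) (p : ℕ) (hp : 0 < p) (hpq : IsCoprime (p : ℤ) q)
    (hm : (s : ℝ) / 2 - m = (q : ℝ) / (p : ℝ))
    (C : MPS.CanonicalForm (s + 1)) (hC : C.IsFormOf A) :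
    (∃ γ : ℕ, 0 < γ ∧ ∀ k : Fin C.numBlocks,
      ∃ c : ℕ, c ∣ γ ∧ MPS.IsPeriodic (C.block k) (c * p)) ∧
    (∀ k l : Fin C.numBlocks, MPS.period (C.block k) ≠ MPS.period (C.block l) →
      ∃ N₀ : ℕ, ∀ N : ℕ, N₀ ≤ N →
        (MPS.period (C.block k) ∣ N ∨ MPS.period (C.block l) ∣ N) →
        ∀ z : ℂ, z ≠ 0 →
          MPS.state (C.block k) N ≠ z • MPS.state (C.block l) N) := by

  have hsymC : ∀ N : ℕ, 0 < N → n₀ ∣ N → MPS.IsU1Symmetric s m N (MPS.state C.matrices N) :=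
    fun N hN hdvd => hC N hN ▸ hsym N hN hdvd
  have hdvd (k : Fin C.numBlocks) : p ∣ MPS.period (C.block k) := by
    refine (C.canonical k).dvd_period fun N hN hne => ?_
    obtain ⟨w, hw⟩ := Function.ne_iff.mp hne
    have hsum := C.sum_eq_of_state_block_ne_zero hn₀ hsymC k hN hw
    rw [hm, mul_div_assoc', eq_div_iff (by exact_mod_cast hp.ne')] at hsum
    -- An integer index sum equal to `N q / p` forces `p ∣ N`, by coprimality.
    have hsumZ : ((∑ k, (w k : ℕ) : ℕ) : ℤ) * (p : ℤ) = (N : ℤ) * q := by exact_mod_cast hsum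
    exact Int.natCast_dvd_natCast.mp
      (hpq.dvd_of_dvd_mul_right (hsumZ ▸ dvd_mul_left (p : ℤ) _))
  constructor
  -- Any positive common multiple of the quotients serves as `γ`; the product is one.
  · refine ⟨∏ k, MPS.period (C.block k) / p, Finset.prod_pos fun k _ =>
      Nat.div_pos (Nat.le_of_dvd (C.canonical k).period_pos (hdvd k)) hp, fun k =>
      ⟨MPS.period (C.block k) / p, Finset.dvd_prod_of_mem _ (Finset.mem_univ k), ?_⟩⟩
    rw [Nat.div_mul_cancel (hdvd k)]
    exact (C.canonical k).isPeriodic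
  · exact fun k l hkl => Filter.eventually_atTop.mp
      ((C.canonical k).eventually_state_ne_smul (C.canonical l) hkl)
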